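/- Let $X$ be a zero-dimensional Polish space (that is, a separable completely metrizable space with a base of clopen sets) that is not locally compact. Let $2=\{0,1\}$ carry the discrete topology, let $C_k(X,2)$ be the set of continuous functions $X\to 2$ with the compact-open topology, and let $X'$ be the set of non-isolated points of $X$. Then $C_k(X,2)$ is sequential (every sequentially closed subset is closed) if and only if $X'$ is compact. -/

import Mathlib

open Set Filter Topology TopologicalSpace

/-! If `X'` is not compact, clopen sets `E n` decrease to `∅`, each containing a non-isolated point
`z n`, and the failure of local compactness at `p` gives clopen sets `A n m` that tend to `p` as `n
→ ∞` but, for each `n`, escape any given compact set. The indicators of `A n m ∪ N n m`, with `N n m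
⊆ E n` clopen around `z n`, accumulate at `0`, yet no sequence of them leaves their range: `z n`
obstructs limits with `n` fixed, `p` those with `n → ∞`.

If `X'` is compact with clopen neighbourhood base `U n`, and `f` lies outside a sequentially closed
`S`, the functions equal to `f` on `U n` form a Cantor cube, finite or infinite. There `S` is
closed, so finite sets `F n` can be chosen inductively with no member of `S` equal to `f` on `U n ∪
F n`. Taking new points of `F (n + 1)` in `U n` makes `X' ∪ ⋃ F n` compact, and agreement with `f`
on it excludes membership in `S`. -/

/-- In a second countable zero-dimensional space, a closed set that is not compact meets every
term of some decreasing sequence of clopen sets with empty intersection. -/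
theorem exists_antitone_isClopen_of_not_isCompact {X : Type*} [TopologicalSpace X]
    [SecondCountableTopology X] (hzero : IsTopologicalBasis {s : Set X | IsClopen s})
    {T : Set X} (hT : IsClosed T) (hTc : ¬ IsCompact T) :
    ∃ E : ℕ → Set X, Antitone E ∧ (∀ n, IsClopen (E n)) ∧ (⋂ n, E n) = ∅ ∧
      ∀ n, (E n ∩ T).Nonempty := by
  have h : ¬ ∀ {ι : Type _} (U : ι → Set X), (∀ i, IsOpen (U i)) → (T ⊆ ⋃ i, U i) →
      ∃ t : Finset ι, T ⊆ ⋃ i ∈ t, U i := fun h => hTc (isCompact_of_finite_subcover h)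
  push Not at h
  obtain ⟨ι, U, hUo, hTU, hU⟩ := h
  have hloc : ∀ x, ∃ V : Set X, IsClopen V ∧ x ∈ V ∧ ((∃ i, V ⊆ U i) ∨ V ⊆ Tᶜ) := by
    intro x
    by_cases hx : x ∈ T
    · obtain ⟨i, hi⟩ := mem_iUnion.1 (hTU hx)
      obtain ⟨V, hV, hxV, hVU⟩ := hzero.exists_subset_of_mem_open hi (hUo i)
      exact ⟨V, hV, hxV, Or.inl ⟨i, hVU⟩⟩
    · obtain ⟨V, hV, hxV, hVU⟩ := hzero.exists_subset_of_mem_open (a := x) hx hT.isOpen_compl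
      exact ⟨V, hV, hxV, Or.inr hVU⟩
  choose f hfc hxf hf using hloc
  obtain ⟨s, hs, hcov⟩ := _root_.countable_cover_nhds fun x => (hfc x).isOpen.mem_nhds (hxf x)
  have hne : s.Nonempty := by
    by_contra hse
    rw [not_nonempty_iff_eq_empty] at hse
    have hT0 : T = ∅ := by
      rw [eq_empty_iff_forall_notMem]
      intro x
      have : x ∈ ⋃ x ∈ s, f x := hcov ▸ mem_univ x
      simp [hse] at this
    exact hTc (hT0 ▸ isCompact_empty)
  obtain ⟨e, rfl⟩ := hs.exists_eq_range hne
  refine ⟨fun n => ⋂ i ∈ Finset.range n, (f (e i))ᶜ, ?_, ?_, ?_, ?_⟩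
  · intro m n hmn
    exact biInter_subset_biInter_left fun i hi => by
      simp only [Finset.mem_coe, Finset.mem_range] at hi ⊢; omega
  · exact fun n => isClopen_biInter_finset fun i _ => (hfc _).compl
  · rw [eq_empty_iff_forall_notMem]
    intro x hx
    have : x ∈ ⋃ x ∈ range e, f x := hcov ▸ mem_univ x
    simp only [mem_range, iUnion_exists, iUnion_iUnion_eq', mem_iUnion] at this
    obtain ⟨i, hi⟩ := this
    have h2 := mem_iInter.1 hx (i + 1)
    simp only [Finset.mem_range, mem_iInter] at h2
    exact h2 i (by omega) hi
  · intro n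
    -- Each `f (e i)` lies in a single `U j` or misses `T`, so finitely many of them cannot cover
    -- `T`.
    have key : ∀ n : ℕ, ∃ t : Finset ι, ∀ x ∈ T, (∃ i < n, x ∈ f (e i)) → ∃ j ∈ t, x ∈ U j := by
      classical
      intro n
      induction n with
      | zero => exact ⟨∅, fun x _ ⟨i, hi, _⟩ => absurd hi (Nat.not_lt_zero _)⟩
      | succ n ih =>
        obtain ⟨t, ht⟩ := ih
        rcases hf (e n) with ⟨j, hj⟩ | hj
        · refine ⟨insert j t, fun x hxT ⟨i, hi, hxi⟩ => ?_⟩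
          rcases Nat.lt_succ_iff_lt_or_eq.1 hi with hi | rfl
          · obtain ⟨k, hk, hxk⟩ := ht x hxT ⟨i, hi, hxi⟩
            exact ⟨k, Finset.mem_insert_of_mem hk, hxk⟩
          · exact ⟨j, Finset.mem_insert_self _ _, hj hxi⟩
        · refine ⟨t, fun x hxT ⟨i, hi, hxi⟩ => ?_⟩
          rcases Nat.lt_succ_iff_lt_or_eq.1 hi with hi | rfl
          · exact ht x hxT ⟨i, hi, hxi⟩
          · exact absurd hxT (hj hxi)
    obtain ⟨t, ht⟩ := key n
    obtain ⟨x, hxT, hx⟩ := not_subset.1 (hU t)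
    refine ⟨x, mem_iInter₂.2 fun i hi hxi => hx ?_, hxT⟩
    obtain ⟨j, hj, hxj⟩ := ht x hxT ⟨i, Finset.mem_range.1 hi, hxi⟩
    exact mem_iUnion₂.2 ⟨j, hj, hxj⟩

/-- A compact set misses some term of a decreasing sequence of closed sets with empty
intersection. -/
theorem IsCompact.exists_disjoint_of_antitone {X : Type*} [TopologicalSpace X] {L : Set X}
    (hL : IsCompact L) {E : ℕ → Set X} (hanti : Antitone E) (hE : ∀ n, IsClosed (E n))
    (hempty : (⋂ n, E n) = ∅) : ∃ n, Disjoint L (E n) := by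
  obtain ⟨n, hn⟩ := hL.elim_directed_family_closed E hE (by simp [hempty]) hanti.directed_ge
  exact ⟨n, disjoint_iff_inter_eq_empty.2 hn⟩

/-! ### The compact-open topology with discrete target -/

/-- For a discrete target, agreement on a compact set is an open condition in the compact-open
topology. -/
theorem ContinuousMap.eventually_eqOn {X Y : Type*} [TopologicalSpace X] [TopologicalSpace Y]
    [DiscreteTopology Y] [Finite Y] (f : C(X, Y)) {L : Set X} (hL : IsCompact L) :
    ∀ᶠ g : C(X, Y) in 𝓝 f, EqOn g f L := by
  have h : ∀ y : Y, ∀ᶠ g : C(X, Y) in 𝓝 f, MapsTo g (L ∩ f ⁻¹' {y}) {y} := fun y =>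
    ContinuousMap.eventually_mapsTo
      (hL.inter_right ((isClosed_discrete {y}).preimage f.continuous)) (isOpen_discrete {y})
      fun x hx => hx.2
  filter_upwards [eventually_all.2 h] with g hg x hx
  exact hg (f x) ⟨hx, rfl⟩

/-- Every neighbourhood of `f` in the compact-open topology contains all functions that agree
with `f` on a suitable compact set. -/
theorem ContinuousMap.exists_isCompact_eqOn_subset {X Y : Type*} [TopologicalSpace X]
    [TopologicalSpace Y] (f : C(X, Y)) {s : Set C(X, Y)} (hs : s ∈ 𝓝 f) :
    ∃ L : Set X, IsCompact L ∧ ∀ g : C(X, Y), EqOn g f L → g ∈ s := by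
  obtain ⟨S, ⟨hfin, hS⟩, hSs⟩ := f.hasBasis_nhds.mem_iff.1 hs
  refine ⟨⋃ KU ∈ S, KU.1, hfin.isCompact_biUnion fun KU hKU => (hS KU.1 KU.2 hKU).1,
    fun g hg => hSs ?_⟩
  refine mem_iInter₂.2 fun KU hKU x hx => ?_
  rw [hg (mem_iUnion₂.2 ⟨KU, hKU, hx⟩)]
  exact (hS KU.1 KU.2 hKU).2.2 hx

/-- Compact-open convergence of maps into a finite discrete space is continuous convergence along
sequences. -/
theorem ContinuousMap.eventually_apply_eq_of_tendsto {X Y : Type*} [TopologicalSpace X]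
    [TopologicalSpace Y] [DiscreteTopology Y] [Finite Y] {h : ℕ → C(X, Y)} {g : C(X, Y)}
    (hg : Tendsto h atTop (𝓝 g)) {a : ℕ → X} {p : X} (ha : Tendsto a atTop (𝓝 p)) :
    ∀ᶠ j in atTop, h j (a j) = g p := by
  have h1 := hg.eventually (g.eventually_eqOn ha.isCompact_insert_range)
  have h2 : ∀ᶠ j in atTop, g (a j) = g p := by
    have := ((g.continuous.tendsto p).comp ha).eventually
      ((isOpen_discrete {g p}).mem_nhds (mem_singleton _))
    exact this
  filter_upwards [h1, h2] with j h1 h2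
  rw [h1 (mem_insert_of_mem _ (mem_range_self j)), h2]

/-- The indicator function of a clopen set, as a continuous map to `Fin 2`. -/
noncomputable def clopenIndicator {X : Type*} [TopologicalSpace X] {U : Set X} (hU : IsClopen U) :
    C(X, Fin 2) where
  toFun := U.indicator fun _ => 1
  continuous_toFun := continuous_const.indicator (by simp [hU.frontier_eq])

theorem clopenIndicator_of_mem {X : Type*} [TopologicalSpace X] {U : Set X} (hU : IsClopen U)
    {x : X} (hx : x ∈ U) : clopenIndicator hU x = 1 := by
  simp [clopenIndicator, hx]

theorem clopenIndicator_of_notMem {X : Type*} [TopologicalSpace X] {U : Set X} (hU : IsClopen U)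
    {x : X} (hx : x ∉ U) : clopenIndicator hU x = 0 := by
  simp [clopenIndicator, hx]

/-! ### Noncompact `X'`: a sequentially closed set that is not closed -/

/-- A point without compact neighbourhoods is the limit of a sequence of noncompact regions, each
exhausted from inside by the complements of a decreasing sequence of clopen sets. -/
theorem exists_clopen_fan {X : Type*} [TopologicalSpace X] [SecondCountableTopology X]
    (hzero : IsTopologicalBasis {s : Set X | IsClopen s}) {p : X}
    (hp : ∀ V ∈ 𝓝 p, ¬ IsCompact V) {O : Set X} (hO : IsOpen O) (hpO : p ∈ O) :
    ∃ A : ℕ → ℕ → Set X, (∀ n m, IsClopen (A n m)) ∧ (∀ n m, (A n m).Nonempty) ∧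
      (∀ n m, A n m ⊆ O) ∧ (∀ n m, p ∉ A n m) ∧ (∀ V ∈ 𝓝 p, ∀ᶠ n in atTop, ∀ m, A n m ⊆ V) ∧
      ∀ n, ∀ L : Set X, IsCompact L → ∃ m, Disjoint L (A n m) := by
  obtain ⟨B, hB, hBb⟩ := (hzero.nhds_hasBasis (a := p)).exists_antitone_subbasis
  have hstep : ∀ n, ∃ A : ℕ → Set X, (∀ m, IsClopen (A m)) ∧ (∀ m, (A m).Nonempty) ∧
      (∀ m, A m ⊆ O) ∧ (∀ m, p ∉ A m) ∧ (∀ m, A m ⊆ B n) ∧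
      ∀ L : Set X, IsCompact L → ∃ m, Disjoint L (A m) := by
    intro n
    obtain ⟨V, hV, hpV, hVO⟩ := hzero.exists_subset_of_mem_open (a := p) (u := B n ∩ O)
      ⟨(hB n).2, hpO⟩ ((hB n).1.isOpen.inter hO)
    obtain ⟨E, hanti, hEc, hE, hne⟩ := exists_antitone_isClopen_of_not_isCompact hzero
      hV.isClosed (hp V (hV.isOpen.mem_nhds hpV))
    obtain ⟨k, hk⟩ := (isCompact_singleton (x := p)).exists_disjoint_of_antitone hanti
      (fun n => (hEc n).isClosed) hE
    rw [disjoint_singleton_left] at hk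
    refine ⟨fun m => E (m + k) ∩ V, fun m => (hEc _).inter hV, fun m => hne _,
      fun m x hx => (hVO hx.2).2, fun m hm => hk (hanti (by omega) hm.1),
      fun m x hx => (hVO hx.2).1, fun L hL => ?_⟩
    obtain ⟨m, hm⟩ := hL.exists_disjoint_of_antitone hanti (fun n => (hEc n).isClosed) hE
    exact ⟨m, hm.mono_right fun x hx => hanti (by omega) hx.1⟩
  choose A h1 h2 h3 h4 h5 h6 using hstep
  refine ⟨A, h1, h2, h3, h4, fun V hV => ?_, h6⟩
  obtain ⟨n, -, hn⟩ := hBb.1.mem_iff.1 hV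
  filter_upwards [eventually_ge_atTop n] with k hk m
  exact (h5 k m).trans ((hBb.2 hk).trans hn)

theorem exists_seq_tendsto_of_mem_derivedSet {X : Type*} [TopologicalSpace X]
    [FirstCountableTopology X] {z : X} (hz : z ∈ derivedSet (univ : Set X)) {O : Set X}
    (hO : O ∈ 𝓝 z) :
    ∃ b : ℕ → X, Tendsto b atTop (𝓝 z) ∧ ∀ m, b m ≠ z ∧ b m ∈ O := by
  rw [mem_derivedSet, principal_univ, AccPt, inf_top_eq] at hz
  obtain ⟨b, hb⟩ := exists_seq_tendsto (𝓝[≠] z)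
  have h1 : ∀ᶠ m in atTop, b m ≠ z ∧ b m ∈ O :=
    (hb.eventually self_mem_nhdsWithin).and (hb.eventually (mem_nhdsWithin_of_mem_nhds hO))
  obtain ⟨k, hk⟩ := eventually_atTop.1 h1
  exact ⟨fun m => b (m + k), (tendsto_add_atTop_iff_nat k).2 (hb.mono_right nhdsWithin_le_nhds),
    fun m => hk _ (by omega)⟩

theorem tendsto_atTop_of_forall_eventually_ne {α : Type*} {l : Filter α} {u : α → ℕ}
    (hu : ∀ n, ∀ᶠ j in l, u j ≠ n) : Tendsto u l atTop := by
  refine tendsto_atTop.2 fun b => ?_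
  filter_upwards [(eventually_all_finset (Finset.range b)).2 fun i _ => hu i] with j hj
  by_contra h
  exact hj (u j) (Finset.mem_range.2 (not_le.1 h)) rfl

theorem not_sequentialSpace_of_not_isCompact_derivedSet {X : Type*} [TopologicalSpace X]
    [SecondCountableTopology X] [T2Space X]
    (hzero : IsTopologicalBasis {s : Set X | IsClopen s})
    {p : X} (hp : ∀ V ∈ 𝓝 p, ¬ IsCompact V)
    (hK : ¬ IsCompact (derivedSet (univ : Set X))) : ¬ SequentialSpace C(X, Fin 2) := by
  intro hseq
  obtain ⟨E, hanti, hEc, hE, hEp, hne⟩ : ∃ E : ℕ → Set X, Antitone E ∧ (∀ n, IsClopen (E n)) ∧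
      (⋂ n, E n) = ∅ ∧ (∀ n, p ∉ E n) ∧ ∀ n, (E n ∩ derivedSet univ).Nonempty := by
    obtain ⟨E, hanti, hEc, hE, hne⟩ := exists_antitone_isClopen_of_not_isCompact hzero
      (isClosed_derivedSet _) hK
    obtain ⟨k, hk⟩ := (isCompact_singleton (x := p)).exists_disjoint_of_antitone hanti
      (fun n => (hEc n).isClosed) hE
    rw [disjoint_singleton_left] at hk
    refine ⟨fun m => E (m + k), fun a b hab => hanti (by omega), fun m => hEc _, ?_,
      fun m hm => hk (hanti (by omega) hm), fun m => hne _⟩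
    rw [eq_empty_iff_forall_notMem] at hE ⊢
    exact fun x hx => hE x (mem_iInter.2 fun i => hanti (by omega) (mem_iInter.1 hx i))
  choose z hzE hz using hne
  obtain ⟨A, hAc, hAne, hAE, hpA, hAp, hAL⟩ :=
    exists_clopen_fan hzero hp (hEc 0).compl.isOpen (hEp 0)
  choose b hbz hb using fun n =>
    exists_seq_tendsto_of_mem_derivedSet (hz n) ((hEc n).isOpen.mem_nhds (hzE n))
  -- Omitting `b n m`, which tends to `z n` as `m → ∞`, keeps the indicators from converging along a
  -- fixed `n`.
  have hN : ∀ n m, ∃ N : Set X, IsClopen N ∧ z n ∈ N ∧ N ⊆ E n ∩ {b n m}ᶜ := fun n m =>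
    hzero.exists_subset_of_mem_open (a := z n) ⟨hzE n, (hb n m).1.symm⟩
      ((hEc n).isOpen.inter isOpen_compl_singleton)
  choose N hNc hzN hNE using hN
  have hAE' : ∀ n m k, Disjoint (A n m) (E k) := fun n m k =>
    disjoint_left.2 fun x hx hxE => hAE n m hx (hanti (Nat.zero_le k) hxE)
  let H : ℕ × ℕ → C(X, Fin 2) := fun q => clopenIndicator ((hAc q.1 q.2).union (hNc q.1 q.2))
  have hclosed : IsClosed (range H) := by
    refine IsSeqClosed.isClosed fun h g hh hg => ?_
    choose s hs using hh
    obtain rfl : (fun j => H (s j)) = h := funext hs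
    have hev : ∀ x, ∀ᶠ j in atTop, H (s j) x = g x := fun x =>
      -- Constant sequences of points turn continuous convergence into pointwise convergence.
      ContinuousMap.eventually_apply_eq_of_tendsto hg (tendsto_const_nhds (x := x))
    by_cases hconst : ∃ q, ∃ᶠ j in atTop, s j = q
    · obtain ⟨q, hq⟩ := hconst
      refine ⟨q, ContinuousMap.ext fun x => ?_⟩
      obtain ⟨j, hj, hj'⟩ := (hq.and_eventually (hev x)).exists
      rw [← hj', hj]
    exfalso
    push Not at hconst
    by_cases hn : ∃ n, ∃ᶠ j in atTop, (s j).1 = n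
    · obtain ⟨n, hn⟩ := hn
      obtain ⟨φ, hφ, hφn⟩ := extraction_of_frequently_atTop hn
      have hm : Tendsto (fun j => (s (φ j)).2) atTop atTop :=
        tendsto_atTop_of_forall_eventually_ne fun m =>
          (hφ.tendsto_atTop.eventually (hconst (n, m))).mono fun j hj hjm =>
            hj (Prod.ext (hφn j) hjm)
      have hgφ : Tendsto (fun j => H (s (φ j))) atTop (𝓝 g) := hg.comp hφ.tendsto_atTop
      have h0 := ContinuousMap.eventually_apply_eq_of_tendsto hgφ ((hbz n).comp hm)
      have h1 := ContinuousMap.eventually_apply_eq_of_tendsto hgφ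
        (tendsto_const_nhds (x := z n))
      obtain ⟨j, h0, h1⟩ := (h0.and h1).exists
      rw [← h1, Function.comp_apply] at h0
      have hz1 : H (s (φ j)) (z n) = 1 := clopenIndicator_of_mem _ (Or.inr (by
        have := hzN (s (φ j)).1 (s (φ j)).2
        rwa [hφn] at this ⊢))
      have hb0 : H (s (φ j)) (b n (s (φ j)).2) = 0 := clopenIndicator_of_notMem _ (by
        rintro (hx | hx)
        · exact disjoint_left.1 (hAE' _ _ n) hx (hb n _).2
        · rw [hφn] at hx
          exact (hNE n _ hx).2 rfl)
      rw [hz1, hb0] at h0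
      exact absurd h0 (by decide)
    -- Now the first index tends to infinity: points of the sets `A` carry the value `1` and tend to
    -- `p`, where the value is `0`.
    · push Not at hn
      choose a ha using fun q : ℕ × ℕ => hAne q.1 q.2
      have hn' : Tendsto (fun j => (s j).1) atTop atTop :=
        tendsto_atTop_of_forall_eventually_ne hn
      have hap : Tendsto (fun j => a (s j)) atTop (𝓝 p) := fun V hV => by
        rw [mem_map]
        filter_upwards [hn'.eventually (hAp V hV)] with j hj
        exact hj _ (ha (s j))
      obtain ⟨j, h0, h1⟩ :=
        ((ContinuousMap.eventually_apply_eq_of_tendsto hg hap).and (hev p)).exists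
      have hp0 : H (s j) p = 0 := clopenIndicator_of_notMem _ (by
        rintro (hx | hx)
        · exact hpA _ _ hx
        · exact hEp _ (hNE _ _ hx).1)
      have ha1 : H (s j) (a (s j)) = 1 := clopenIndicator_of_mem _ (Or.inl (ha _))
      rw [← h1, hp0, ha1] at h0
      exact absurd h0 (by decide)
  have h0 : (0 : C(X, Fin 2)) ∉ range H := by
    rintro ⟨q, hq⟩
    have h1 : H q (z q.1) = 1 := clopenIndicator_of_mem _ (Or.inr (hzN _ _))
    rw [hq] at h1
    exact absurd h1 (by simp)
  obtain ⟨L, hL, hLs⟩ := ContinuousMap.exists_isCompact_eqOn_subset (0 : C(X, Fin 2))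
    (hclosed.isOpen_compl.mem_nhds h0)
  -- The order matters: `L` determines `n`, and only then `m`.
  obtain ⟨n, hn⟩ := hL.exists_disjoint_of_antitone hanti (fun n => (hEc n).isClosed) hE
  obtain ⟨m, hm⟩ := hAL n L hL
  refine hLs (H (n, m)) (fun x hx => ?_) (mem_range_self _)
  refine clopenIndicator_of_notMem _ ?_
  rintro (h | h)
  · exact disjoint_left.1 hm hx h
  · exact disjoint_left.1 hn hx (hNE n m h).1

/-! ### Compact `X'`: sequentially closed sets are closed -/

theorem exists_isClopen_between {X : Type*} [TopologicalSpace X]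
    (hzero : IsTopologicalBasis {s : Set X | IsClopen s}) {K O : Set X} (hK : IsCompact K)
    (hO : IsOpen O) (hKO : K ⊆ O) : ∃ V : Set X, IsClopen V ∧ K ⊆ V ∧ V ⊆ O := by
  refine hK.induction_on (p := fun s => ∃ V : Set X, IsClopen V ∧ s ⊆ V ∧ V ⊆ O)
    ⟨∅, isClopen_empty, Subset.rfl, empty_subset _⟩
    (fun s t hst ⟨V, hV, htV, hVO⟩ => ⟨V, hV, hst.trans htV, hVO⟩)
    (fun s t ⟨V, hV, hsV, hVO⟩ ⟨W, hW, htW, hWO⟩ =>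
      ⟨V ∪ W, hV.union hW, union_subset_union hsV htW, union_subset hVO hWO⟩) fun x hx => ?_
  obtain ⟨V, hV, hxV, hVO⟩ := hzero.exists_subset_of_mem_open (hKO hx) hO
  exact ⟨V, mem_nhdsWithin_of_mem_nhds (hV.isOpen.mem_nhds hxV), V, hV, Subset.rfl, hVO⟩

/-- A compact subset of a zero-dimensional metrizable space has a countable decreasing clopen
neighbourhood base. -/
theorem IsCompact.exists_antitone_isClopen_basis {X : Type*} [TopologicalSpace X]
    [MetrizableSpace X] (hzero : IsTopologicalBasis {s : Set X | IsClopen s}) {K : Set X}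
    (hK : IsCompact K) :
    ∃ U : ℕ → Set X, Antitone U ∧ U 0 = univ ∧ (∀ n, IsClopen (U n)) ∧ (∀ n, K ⊆ U n) ∧
      ∀ O, IsOpen O → K ⊆ O → ∃ n, U n ⊆ O := by
  let _ := metrizableSpaceMetric X
  choose V hVc hKV hV using fun n : ℕ => exists_isClopen_between hzero hK
    (Metric.isOpen_thickening (δ := 1 / ((n : ℝ) + 1)) (E := K))
    (Metric.self_subset_thickening Nat.one_div_pos_of_nat K)
  refine ⟨fun n => ⋂ i ∈ Finset.range n, V i, fun m n hmn => ?_, by simp,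
    fun n => isClopen_biInter_finset fun i _ => hVc i, fun n => subset_iInter₂ fun i _ => hKV i,
    fun O hO hKO => ?_⟩
  · exact biInter_subset_biInter_left fun i hi => by
      simp only [Finset.mem_coe, Finset.mem_range] at hi ⊢; omega
  · obtain ⟨δ, hδ, hδO⟩ := hK.exists_thickening_subset_open hO hKO
    obtain ⟨n, hn⟩ := exists_nat_one_div_lt hδ
    refine ⟨n + 1, (biInter_subset_of_mem (by simp : n ∈ _)).trans ?_⟩
    exact (hV n).trans ((Metric.thickening_mono hn.le K).trans hδO)

/-- Let `V` be a clopen set outside of which all points are isolated, and `S` a sequentially closed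
set of functions. If no member of `S` agrees with `f` on `V ∪ Q`, this is already witnessed by
finitely many points of `Q`. -/
theorem exists_finset_of_isSeqClosed {X : Type*} [TopologicalSpace X] [SecondCountableTopology X]
    {V : Set X} (hV : IsClopen V) (hiso : ∀ x ∉ V, IsOpen {x}) {S : Set C(X, Fin 2)}
    (hS : IsSeqClosed S) (f : C(X, Fin 2)) {Q : Set X}
    (hQ : ∀ g ∈ S, EqOn g f V → ¬ EqOn g f Q) :
    ∃ F : Set X, F.Finite ∧ F ⊆ Q ∧ ∀ g ∈ S, EqOn g f V → ¬ EqOn g f F := by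
  classical
  have hdisc : DiscreteTopology ↥Vᶜ := by
    refine discreteTopology_iff_isOpen_singleton.2 fun x => ?_
    have : ({x} : Set ↥Vᶜ) = Subtype.val ⁻¹' {(x : X)} := by
      ext y; simp [Subtype.ext_iff]
    rw [this]
    exact (hiso x x.2).preimage continuous_subtype_val
  have hcount : Countable ↥Vᶜ := separableSpace_iff_countable.1 inferInstance
  -- `G` parametrizes the functions equal to `f` on `V` by their arbitrary values on the discrete
  -- set `Vᶜ`.
  let G : (↥Vᶜ → Fin 2) → X → Fin 2 := fun u x => if hx : x ∈ V then f x else u ⟨x, hx⟩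
  have hG : Continuous (Function.uncurry G) := by
    rw [continuous_iff_continuousAt]
    rintro ⟨u, x⟩
    by_cases hx : x ∈ V
    · have hc : ContinuousAt (fun q : (↥Vᶜ → Fin 2) × X => f q.2) (u, x) := by fun_prop
      refine hc.congr ?_
      filter_upwards [(hV.isOpen.preimage continuous_snd).mem_nhds
        (show (u, x) ∈ Prod.snd ⁻¹' V from hx)] with q hq
      exact (show G q.1 q.2 = f q.2 from dif_pos hq).symm
    · have hc : ContinuousAt (fun q : (↥Vᶜ → Fin 2) × X => q.1 ⟨x, hx⟩) (u, x) := by fun_prop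
      refine hc.congr ?_
      filter_upwards [((hiso x hx).preimage continuous_snd).mem_nhds
        (show (u, x) ∈ Prod.snd ⁻¹' {x} from rfl)] with q hq
      obtain ⟨v, y⟩ := q
      obtain rfl : y = x := hq
      exact (show G v y = v ⟨y, hx⟩ from dif_neg hx).symm
  let Φ : (↥Vᶜ → Fin 2) → C(X, Fin 2) := fun u => ⟨G u, hG.comp (Continuous.prodMk_right u)⟩
  have hΦ : Continuous Φ := ContinuousMap.continuous_of_continuous_uncurry Φ hG
  have hΦV : ∀ u, EqOn (Φ u) f V := fun u x hx => dif_pos hx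
  have hΦs : ∀ g : C(X, Fin 2), EqOn g f V → Φ (fun d => g d) = g := fun g hg =>
    ContinuousMap.ext fun x => by
      by_cases hx : x ∈ V
      · exact (dif_pos hx).trans (hg hx).symm
      · exact dif_neg hx
  -- As `Vᶜ` is countable, the cube is first countable, so sequentially closed sets in it are
  -- closed, hence compact.
  have hcl : IsClosed (Φ ⁻¹' S) := (hS.preimage hΦ.seqContinuous).isClosed
  obtain ⟨t, ht⟩ := hcl.isCompact.elim_finite_subfamily_closed
    (fun x : Q => {u | Φ u x = f x})
    (fun x => isClosed_eq ((continuous_eval_const (x : X)).comp hΦ)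
      continuous_const) (by
      rw [eq_empty_iff_forall_notMem]
      rintro u ⟨huS, hu⟩
      exact hQ _ huS (hΦV u) fun x hx => mem_iInter.1 hu ⟨x, hx⟩)
  refine ⟨Subtype.val '' (t : Set Q), t.finite_toSet.image _, ?_, fun g hgS hgV hgF => ?_⟩
  · rintro _ ⟨x, -, rfl⟩
    exact x.2
  · rw [eq_empty_iff_forall_notMem] at ht
    refine ht (fun d => g d) ⟨?_, mem_iInter₂.2 fun x hx => ?_⟩
    · rw [mem_preimage, hΦs g hgV]
      exact hgS
    · rw [mem_ofPred_eq, hΦs g hgV]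
      exact hgF ⟨x, hx, rfl⟩

theorem isOpen_singleton_of_notMem_derivedSet {X : Type*} [TopologicalSpace X] {x : X}
    (hx : x ∉ derivedSet (univ : Set X)) : IsOpen {x} := by
  rw [mem_derivedSet, principal_univ, AccPt, inf_top_eq, not_neBot] at hx
  exact (isOpen_singleton_iff_punctured_nhds x).2 hx

theorem sequentialSpace_of_isCompact_derivedSet {X : Type*} [TopologicalSpace X]
    [SecondCountableTopology X] [MetrizableSpace X]
    (hzero : IsTopologicalBasis {s : Set X | IsClopen s})
    (hK : IsCompact (derivedSet (univ : Set X))) : SequentialSpace C(X, Fin 2) := by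
  refine ⟨fun S hS => ?_⟩
  rw [← isOpen_compl_iff, isOpen_iff_mem_nhds]
  intro f hf
  obtain ⟨U, hanti, hU0, hUc, hKU, hU⟩ := hK.exists_antitone_isClopen_basis hzero
  have hiso : ∀ n, ∀ x ∉ U n, IsOpen {x} := fun n x hx =>
    isOpen_singleton_of_notMem_derivedSet fun h => hx (hKU n h)
  let P : ℕ → Set X → Prop := fun n F => F.Finite ∧ ∀ g ∈ S, EqOn g f (U n) → ¬ EqOn g f F
  have hstep : ∀ n F, P n F → ∃ F', P (n + 1) F' ∧ F ⊆ F' ∧ F' ⊆ U n ∪ F := by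
    rintro n F ⟨hF, hFS⟩
    obtain ⟨F', hF', hF'Q, hF'S⟩ := exists_finset_of_isSeqClosed (hUc (n + 1)) (hiso (n + 1)) hS f
      (Q := U n ∪ F) fun g hg _ hgQ =>
        hFS g hg (hgQ.mono subset_union_left) (hgQ.mono subset_union_right)
    exact ⟨F' ∪ F, ⟨hF'.union hF, fun g hg hgU hgF =>
      hF'S g hg hgU (hgF.mono subset_union_left)⟩, subset_union_right,
      union_subset hF'Q subset_union_right⟩
  have hzero' : P 0 ∅ := by
    refine ⟨finite_empty, fun g hg hgU _ => hf ?_⟩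
    rw [hU0, eqOn_univ] at hgU
    rwa [← DFunLike.coe_injective hgU]
  choose! next hnext hle hsub using hstep
  let F : ℕ → Set X := fun n => Nat.rec ∅ next n
  have hP : ∀ n, P n (F n) := fun n => by
    induction n with
    | zero => exact hzero'
    | succ n ih => exact hnext n _ ih
  have hmono : Monotone F := monotone_nat_of_le_succ fun n => hle n _ (hP n)
  have hFU : ∀ n k, F (n + k) ⊆ U n ∪ F n := by
    intro n k
    induction k with
    | zero => exact subset_union_right
    | succ k ih =>
      exact (hsub (n + k) _ (hP _)).trans
        (union_subset ((hanti (by omega)).trans subset_union_left) ih)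
  have hFU' : ∀ n, (⋃ m, F m) ⊆ U n ∪ F n := fun n => iUnion_subset fun m =>
    (hmono (by omega)).trans (hFU n m)
  -- A finite subcover of `X'` already covers some `U n`, which contains all of `⋃ m, F m` except
  -- points of the finite set `F n`.
  have hL : IsCompact (derivedSet univ ∪ ⋃ m, F m) := by
    refine isCompact_of_finite_subcover fun {ι} W hW hcov => ?_
    classical
    obtain ⟨t, ht⟩ := hK.elim_finite_subcover W hW (subset_union_left.trans hcov)
    obtain ⟨n, hn⟩ := hU _ (isOpen_biUnion fun i _ => hW i) ht
    obtain ⟨t', ht'⟩ := (hP n).1.isCompact.elim_finite_subcover W hW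
      ((subset_iUnion F n).trans (subset_union_right.trans hcov))
    refine ⟨t ∪ t', ?_⟩
    rw [Finset.set_biUnion_union]
    exact union_subset (ht.trans subset_union_left)
      ((hFU' n).trans (union_subset_union hn ht'))
  filter_upwards [f.eventually_eqOn hL] with g hg hgS
  -- Agreement on `X'` spreads to some `U n`, because the set where `g` and `f` agree is open.
  obtain ⟨n, hn⟩ := hU {x | g x = f x} (isOpen_discrete (diagonal (Fin 2)) |>.preimage
    (g.continuous.prodMk f.continuous)) fun x hx => hg (Or.inl hx)
  exact (hP n).2 g hgS hn (hg.mono ((subset_iUnion F n).trans subset_union_right))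

theorem theorem3p2 {X : Type*} [TopologicalSpace X] [PolishSpace X]
    (hzero : TopologicalSpace.IsTopologicalBasis {s : Set X | IsClopen s})
    (hnlc : ¬ LocallyCompactSpace X) :
    SequentialSpace C(X, Fin 2) ↔ IsCompact (derivedSet (Set.univ : Set X)) := by
  refine ⟨fun hseq => ?_, sequentialSpace_of_isCompact_derivedSet hzero⟩
  by_contra hK
  have hp : ∃ p : X, ∀ V ∈ 𝓝 p, ¬ IsCompact V := by
    by_contra! h
    have : WeaklyLocallyCompactSpace X := ⟨fun x => by
      obtain ⟨V, hV, hVc⟩ := h x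
      exact ⟨V, hVc, hV⟩⟩
    exact hnlc inferInstance
  obtain ⟨p, hp⟩ := hp
  exact not_sequentialSpace_of_not_isCompact_derivedSet hzero hp hK hseq
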